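/- Let $(\Omega,\mathcal A,\mu)$ be a complete $\sigma$-finite measure space with $\mu(\Omega)>0$, and let $M\colon\Omega\rightrightarrows\mathbb R^n$ be a multifunction with closed values that is measurable, i.e. $\{\omega\in\Omega : M(\omega)\cap U\neq\emptyset\}\in\mathcal A$ for every open $U\subset\mathbb R^n$. Let $M_\cap:=\{x\in\mathbb R^n : x\in M(\omega)\text{ for a.e. }\omega\in\Omega\}$ be its essential intersection, and let $\bar x\in M_\cap$. For $\Theta\subset\mathbb R^n$ and $x\in\Theta$, the regular normal cone is $$\hat N(x;\Theta):=\Big\{x^*\in\mathbb R^n : \limsup_{y\to x,\ y\in\Theta,\ y\ne x}\frac{\langle x^*,y-x\rangle}{\|y-x\|}\le 0\Big\}.$$ The limiting normal cone $N(x;\Theta)$ is the set of all limits of sequences $x_k^*\in\hat N(x_k;\Theta)$ with $x_k\to x$, $x_k\in\Theta$. The contingent cone $T(x;\Theta)$ is the set of all limits of sequences $v_k$ for which there exist $\tau_k>0$, $\tau_k\to0$, with $x+\tau_kv_k\in\Theta$ for all $k$. The set $\Theta$ is normally regular at $x$ if $\hat N(x;\Theta)=N(x;\Theta)$. The Aumann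 integral of a multifunction $F\colon\Omega\rightrightarrows\mathbb R^n$ is $$\int_\Omega F(\omega)\,d\mu(\omega):=\Big\{\int_\Omega f\,d\mu : f\in L^1(\Omega,\mathbb R^n),\ f(\omega)\in F(\omega)\text{ for a.e. }\omega\in\Omega\Big\}.$$ Assume that the measurable conical hull intersection property (CHIP) holds for $M$ at $\bar x$, i.e. $$T(\bar x;M_\cap)=\big\{v\in\mathbb R^n : v\in T(\bar x;M(\omega))\text{ for a.e. }\omega\in\Omega\big\}.$$ Then $$\hat N(\bar x;M_\cap)\subset\mathrm{cl}\Big(\int_\Omega N(\bar x;M(\omega))\,d\mu(\omega)\Big).$$ If in addition $M(\omega)$ is normally regular at $\bar x$ for a.e. $\omega\in\Omega$, then this inclusion holds as an equality, and the relative interiors also coincide: $$\mathrm{ri}\big(\hat N(\bar x;M_\cap)\big)=\mathrm{ri}\Big(\int_\Omega N(\bar x;M(\omega))\,d\mu(\omega)\Big).$$ -/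

import Mathlib

open MeasureTheory Filter Topology

namespace EssInter

section Cones

variable {E : Type*} [NormedAddCommGroup E] [InnerProductSpace ℝ E]

/-- The Fréchet regular normal cone `N̂(x; Θ)`: the vectors `v` with
`limsup ⟪v, y - x⟫ / ‖y - x‖ ≤ 0` as `y → x` with `y ∈ Θ`, `y ≠ x`, written out with `ε`
(see `mem_regularNormalCone_iff_limsup`). It is meant for `x ∈ Θ`. -/
def regularNormalCone (Θ : Set E) (x : E) : Set E :=
  {v | ∀ ε : ℝ, 0 < ε → ∀ᶠ y in 𝓝[Θ] x, inner ℝ v (y - x) ≤ ε * ‖y - x‖}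

/-- The Mordukhovich limiting normal cone `N(x; Θ)`: the outer limit of `N̂(y; Θ)` as `y → x`
with `y ∈ Θ`. -/
def limitingNormalCone (Θ : Set E) (x : E) : Set E :=
  {v | ∃ (y : ℕ → E) (w : ℕ → E), (∀ k, y k ∈ Θ) ∧ (∀ k, w k ∈ regularNormalCone Θ (y k)) ∧
    Tendsto y atTop (𝓝 x) ∧ Tendsto w atTop (𝓝 v)}

/-- The Bouligand-Severi contingent cone `T(x; Θ)`: the outer limit of `(Θ - x) / τ` as
`τ ↓ 0`. -/
def contingentCone (Θ : Set E) (x : E) : Set E :=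
  {v | ∃ (τ : ℕ → ℝ) (w : ℕ → E), (∀ k, 0 < τ k) ∧ (∀ k, x + τ k • w k ∈ Θ) ∧
    Tendsto τ atTop (𝓝 0) ∧ Tendsto w atTop (𝓝 v)}

/-- Normal regularity of `Θ` at `x`. -/
def IsNormallyRegularAt (Θ : Set E) (x : E) : Prop :=
  regularNormalCone Θ x = limitingNormalCone Θ x

/-- The `ε`-form of the definition of regular normals agrees with the form by an upper limit,
taken in the extended reals. -/
theorem mem_regularNormalCone_iff_limsup (Θ : Set E) (x v : E) :
    v ∈ regularNormalCone Θ x ↔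
      limsup (fun y => ((inner ℝ v (y - x) / ‖y - x‖ : ℝ) : EReal)) (𝓝[Θ \ {x}] x) ≤ 0 := by
  have key : ∀ ε : ℝ, (∀ᶠ y in 𝓝[Θ] x, inner ℝ v (y - x) ≤ ε * ‖y - x‖) ↔
      ∀ᶠ y in 𝓝[Θ \ {x}] x, inner ℝ v (y - x) / ‖y - x‖ ≤ ε := by
    intro ε
    rw [eventually_nhdsWithin_iff, eventually_nhdsWithin_iff]
    refine eventually_congr (Eventually.of_forall fun y => ?_)
    by_cases hy : y = x
    · simp [hy]
    · have : 0 < ‖y - x‖ := norm_pos_iff.2 (sub_ne_zero.2 hy)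
      simp [hy, div_le_iff₀ this]
  constructor
  · intro h
    refine le_of_forall_gt_imp_ge_of_dense fun a ha => ?_
    induction a with
    | bot => simp at ha
    | top => exact le_top
    | coe a =>
      refine limsup_le_of_le (h := ?_)
      filter_upwards [(key a).1 (h a (by exact_mod_cast ha))] with y hy
      exact_mod_cast hy
  · intro h ε hε
    refine (key ε).2 ?_
    have h2 := eventually_lt_of_limsup_lt (lt_of_le_of_lt h (b := (0 : EReal)) (c := (ε : EReal))
      (by exact_mod_cast hε))
    filter_upwards [h2] with y hy
    exact le_of_lt (by exact_mod_cast hy)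

/-- The contingent cone is the positive tangent cone of Mathlib. -/
theorem contingentCone_eq_posTangentConeAt (Θ : Set E) (x : E) :
    contingentCone Θ x = posTangentConeAt Θ x := by
  ext v
  rw [posTangentConeAt, mem_tangentConeAt_iff_exists_seq]
  constructor
  · rintro ⟨τ, w, hτ, hw, hτ0, hwv⟩
    refine ⟨fun k => (τ k).toNNReal⁻¹, fun k => τ k • w k, ?_, Eventually.of_forall hw, ?_⟩
    · simpa using hτ0.smul hwv
    · refine hwv.congr fun k => ?_
      rw [NNReal.smul_def, smul_smul, NNReal.coe_inv, Real.coe_toNNReal _ (hτ k).le,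
        inv_mul_cancel₀ (hτ k).ne', one_smul]
  · rintro ⟨c, d, hd0, hd, hcd⟩
    obtain ⟨N, hN⟩ := eventually_atTop.1 hd
    set s : ℕ → ℝ := fun k => √‖d k‖ + 1 / ((k : ℝ) + 1) with hs
    have hspos : ∀ k, 0 < s k := fun k => by positivity
    have hsq : Tendsto (fun k => √‖d k‖) atTop (𝓝 0) := by
      simpa using hd0.norm.sqrt
    have hs0 : Tendsto s atTop (𝓝 0) := by
      simpa [hs] using hsq.add tendsto_one_div_add_atTop_nhds_zero_nat
    have hsd : Tendsto (fun k => (s k)⁻¹ • d k) atTop (𝓝 0) := by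
      refine squeeze_zero_norm (fun k => ?_) hsq
      rw [norm_smul, norm_inv, Real.norm_of_nonneg (hspos k).le, inv_mul_le_iff₀ (hspos k)]
      have h1 : √‖d k‖ ≤ s k := le_add_of_nonneg_right (by positivity)
      calc ‖d k‖ = √‖d k‖ * √‖d k‖ := (Real.mul_self_sqrt (norm_nonneg _)).symm
        _ ≤ s k * √‖d k‖ := by gcongr
    have hpos : ∀ k, 0 < (c k : ℝ) + (s k)⁻¹ := fun k =>
      add_pos_of_nonneg_of_pos (c k).2 (inv_pos.2 (hspos k))
    have hlim : Tendsto (fun k => ((c k : ℝ) + (s k)⁻¹) • d k) atTop (𝓝 v) := by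
      simpa [add_smul, NNReal.smul_def] using hcd.add hsd
    have hτ0 : Tendsto (fun k => ((c k : ℝ) + (s k)⁻¹)⁻¹) atTop (𝓝 0) := by
      refine squeeze_zero (fun k => (inv_pos.2 (hpos k)).le) (fun k => ?_) hs0
      rw [inv_le_comm₀ (hpos k) (hspos k)]
      exact le_add_of_nonneg_left (c k).2
    refine ⟨fun k => ((c (k + N) : ℝ) + (s (k + N))⁻¹)⁻¹,
      fun k => ((c (k + N) : ℝ) + (s (k + N))⁻¹) • d (k + N),
      fun k => inv_pos.2 (hpos _), fun k => ?_, hτ0.comp (tendsto_add_atTop_nat N),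
      hlim.comp (tendsto_add_atTop_nat N)⟩
    rw [smul_smul, inv_mul_cancel₀ (hpos _).ne', one_smul]
    exact hN _ (Nat.le_add_left _ _)

end Cones

section Multifunctions

variable {Ω : Type*} [MeasurableSpace Ω] {E : Type*}

/-- Measurability of a multifunction: inverse images of open sets are measurable. -/
def MeasurableMultifunction [TopologicalSpace E] (M : Ω → Set E) : Prop :=
  ∀ U : Set E, IsOpen U → MeasurableSet {ω | (M ω ∩ U).Nonempty}

/-- The essential intersection of `M`: the points that lie in `M ω` for almost all `ω`. -/
def essInter (μ : Measure Ω) (M : Ω → Set E) : Set E :=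
  {x | ∀ᵐ ω ∂μ, x ∈ M ω}

/-- The Aumann integral of `M`: the integrals of all integrable a.e. selections. -/
def aumannIntegral [NormedAddCommGroup E] [NormedSpace ℝ E] (μ : Measure Ω) (M : Ω → Set E) :
    Set E :=
  {y | ∃ f : Ω → E, Integrable f μ ∧ (∀ᵐ ω ∂μ, f ω ∈ M ω) ∧ ∫ ω, f ω ∂μ = y}

/-- The measurable conical hull intersection property of `M` at `x`. -/
def MeasurableCHIP [NormedAddCommGroup E] [InnerProductSpace ℝ E] (μ : Measure Ω)
    (M : Ω → Set E) (x : E) : Prop :=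
  contingentCone (essInter μ M) x = essInter μ fun ω => contingentCone (M ω) x

end Multifunctions

end EssInter

/-! Write `T ω` for the contingent cone of `M ω` at `x`. A regular normal `v` of the essential
intersection is polar to its contingent cone, which by CHIP is the essential intersection of the `T
ω`. Pass to a finite measure `ν` equivalent to `μ` and minimise `‖s - v‖² + k ∫ dist(s, T ω)² dν`
over `s`. Comparison with `s = 0` keeps the minimisers bounded and makes the penalty integral
`O(1/k)`. A cluster point `z` as `k → ∞` thus lies in almost every `T ω` and satisfies `‖z - v‖ ≤
‖v‖`; polarity then gives `z = 0`. Stationarity at a minimiser `t` reads `v - t = k ∫ (t - u) dν`,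
with `u ω` nearest to `t` in `T ω`, so `v` is a limit of integrals of proximal normals to the `T ω`
(`mem_closure_integral_sub_of_forall_essInter`). A blow-up argument
(`sub_mem_limitingNormalCone_of_nearest_contingentCone`) shows that these are limiting normals to `M
ω` at `x`.

Under normal regularity, integrating `⟪f ω, z⟫ ≤ 0` gives the reverse inclusion. The Aumann integral
is then convex, hence has the same relative interior as its closure. -/

namespace EssInter

/-! ### Relative interiors of convex sets. -/

section IntrinsicInterior

/-- The intrinsic interior computed in any affine subspace that equals the affine span. -/
theorem intrinsicInterior_eq_image_of_affineSpan_eq {V : Type*} [NormedAddCommGroup V]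
    [NormedSpace ℝ V] {s : Set V} {W : AffineSubspace ℝ V} (h : affineSpan ℝ s = W) :
    intrinsicInterior ℝ s = (↑) '' interior ((↑) ⁻¹' s : Set W) := by
  subst h
  rfl

/-- A convex set and its closure have the same relative interior. -/
theorem intrinsicInterior_closure_of_convex {V : Type*} [NormedAddCommGroup V]
    [NormedSpace ℝ V] [FiniteDimensional ℝ V] {s : Set V} (hs : Convex ℝ s) :
    intrinsicInterior ℝ (closure s) = intrinsicInterior ℝ s := by
  rcases s.eq_empty_or_nonempty with rfl | ⟨p, hp⟩
  · simp
  have hspan : affineSpan ℝ (closure s) = affineSpan ℝ s := by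
    rw [← intrinsicClosure_eq_closure ℝ s, affineSpan_intrinsicClosure]
  rw [intrinsicInterior_eq_image_of_affineSpan_eq hspan, intrinsicInterior]
  congr 1
  have : Nonempty s := ⟨⟨p, hp⟩⟩
  let p' : affineSpan ℝ s := ⟨p, subset_affineSpan _ _ hp⟩
  -- Convexity is not available in the affine span itself; `φ` moves the question to its direction,
  -- a vector space where the set has nonempty interior.
  let φ := (AffineIsometryEquiv.constVSub ℝ p').symm
  have hcl : ((↑) ⁻¹' closure s : Set (affineSpan ℝ s)) = closure ((↑) ⁻¹' s) := by
    have himg : ((↑) : affineSpan ℝ s → V) '' ((↑) ⁻¹' s) = s :=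
      Set.image_preimage_eq_of_subset fun y hy => ⟨⟨y, subset_affineSpan _ _ hy⟩, rfl⟩
    exact ((Topology.IsInducing.subtypeVal.closure_eq_preimage_closure_image _).trans
      (congrArg (fun A => Subtype.val ⁻¹' closure A) himg)).symm
  have hconv : Convex ℝ (φ ⁻¹' ((↑) ⁻¹' s)) :=
    hs.affine_preimage ((affineSpan ℝ s).subtype.comp φ.toAffineEquiv.toAffineMap)
  have hint : (interior (φ ⁻¹' ((↑) ⁻¹' s))).Nonempty := by
    obtain ⟨y, z, hz, rfl⟩ := Set.Nonempty.intrinsicInterior hs ⟨p, hp⟩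
    have := φ.toHomeomorph.preimage_interior ((↑) ⁻¹' s)
    rw [AffineIsometryEquiv.coe_toHomeomorph] at this
    rw [← this]
    exact ⟨φ.symm z, by simpa using hz⟩
  have key := hconv.interior_closure_eq_interior_of_nonempty_interior hint
  have h1 := φ.toHomeomorph.preimage_interior ((↑) ⁻¹' s)
  have h2 := φ.toHomeomorph.preimage_interior (closure ((↑) ⁻¹' s))
  have h3 := φ.toHomeomorph.preimage_closure ((↑) ⁻¹' s)
  rw [AffineIsometryEquiv.coe_toHomeomorph] at h1 h2 h3
  rw [← h3, ← h1, ← h2] at key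
  rw [hcl]
  exact φ.surjective.preimage_injective key

end IntrinsicInterior

/-! ### Contingent, regular normal and limiting normal cones. -/

section Geometry

variable {E : Type*} [NormedAddCommGroup E] [InnerProductSpace ℝ E]

theorem zero_mem_contingentCone {Θ : Set E} {x : E} (hx : x ∈ Θ) :
    (0 : E) ∈ contingentCone Θ x :=
  ⟨fun k => 1 / ((k : ℝ) + 1), fun _ => 0, fun k => by positivity, fun k => by simpa,
    tendsto_one_div_add_atTop_nhds_zero_nat, tendsto_const_nhds⟩

/-- The contingent cone meets a closed ball as soon as the difference quotients of `Θ` meet all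
slightly larger open balls for arbitrarily small step sizes. -/
theorem contingentCone_inter_closedBall_nonempty_iff [FiniteDimensional ℝ E] {Θ : Set E} {x t : E}
    {r : ℝ} :
    (contingentCone Θ x ∩ Metric.closedBall t r).Nonempty ↔
      ∀ j : ℕ, ∃ τ ∈ Set.Ioo (0 : ℝ) (1 / ((j : ℝ) + 1)),
        ∃ y ∈ Metric.ball t (r + 1 / ((j : ℝ) + 1)), x + τ • y ∈ Θ := by
  constructor
  · rintro ⟨z, ⟨τ, w, hτ, hw, hτ0, hwz⟩, hzr⟩ j
    have hj : (0 : ℝ) < 1 / ((j : ℝ) + 1) := by positivity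
    have h1 : ∀ᶠ k in atTop, τ k < 1 / ((j : ℝ) + 1) := hτ0.eventually (gt_mem_nhds hj)
    have h2 : ∀ᶠ k in atTop, w k ∈ Metric.ball t (r + 1 / ((j : ℝ) + 1)) := by
      refine hwz.eventually (Metric.isOpen_ball.mem_nhds ?_)
      rw [Metric.mem_closedBall] at hzr
      rw [Metric.mem_ball]
      linarith
    obtain ⟨k, hk1, hk2⟩ := (h1.and h2).exists
    exact ⟨τ k, ⟨hτ k, hk1⟩, w k, hk2, hw k⟩
  · intro h
    choose τ hτ y hy hmem using h
    have hb : ∀ j, y j ∈ Metric.closedBall t (r + 1) := by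
      intro j
      have := hy j
      rw [Metric.mem_ball] at this
      rw [Metric.mem_closedBall]
      have : 1 / ((j : ℝ) + 1) ≤ 1 := by
        rw [div_le_one (by positivity)]
        linarith [(Nat.cast_nonneg j : (0 : ℝ) ≤ j)]
      linarith
    obtain ⟨z, -, φ, hφ, hlim⟩ := (isCompact_closedBall t (r + 1)).tendsto_subseq hb
    refine ⟨z, ⟨τ ∘ φ, y ∘ φ, fun k => (hτ _).1, fun k => hmem _, ?_, hlim⟩, ?_⟩
    · exact (squeeze_zero (fun k => (hτ k).1.le) (fun k => (hτ k).2.le)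
        tendsto_one_div_add_atTop_nhds_zero_nat).comp hφ.tendsto_atTop
    · rw [Metric.mem_closedBall]
      refine le_of_tendsto_of_tendsto (hlim.dist tendsto_const_nhds)
        (g := fun j => r + 1 / ((φ j : ℝ) + 1)) (a₂ := r) ?_
        (Eventually.of_forall fun k => (Metric.mem_ball.1 (hy (φ k))).le)
      simpa using (tendsto_one_div_add_atTop_nhds_zero_nat (𝕜 := ℝ)).comp hφ.tendsto_atTop
        |>.const_add r

/-- Radius `0` in the preceding criterion takes the place of a diagonal sequence. -/
theorem isClosed_contingentCone [FiniteDimensional ℝ E] (Θ : Set E) (x : E) :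
    IsClosed (contingentCone Θ x) := by
  rw [← closure_subset_iff_isClosed]
  intro z hz
  have : (contingentCone Θ x ∩ Metric.closedBall z 0).Nonempty := by
    rw [contingentCone_inter_closedBall_nonempty_iff]
    intro j
    have hj : (0 : ℝ) < 1 / ((j : ℝ) + 1) := by positivity
    obtain ⟨y, hy, hyz⟩ := Metric.mem_closure_iff.1 hz _ (half_pos hj)
    have h := contingentCone_inter_closedBall_nonempty_iff.1
      (⟨y, hy, Metric.mem_closedBall_self le_rfl⟩ :
        (contingentCone Θ x ∩ Metric.closedBall y 0).Nonempty)
    obtain ⟨i, hi⟩ := exists_nat_one_div_lt (half_pos hj)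
    obtain ⟨τ, hτ, w, hw, hmem⟩ := h i
    refine ⟨τ, ⟨hτ.1, by linarith [hτ.2]⟩, w, ?_, hmem⟩
    rw [Metric.mem_ball] at hw ⊢
    have := dist_triangle w y z
    rw [dist_comm y z] at this
    linarith
  obtain ⟨y, hy, hyz⟩ := this
  rw [Metric.closedBall_zero] at hyz
  rwa [← Set.mem_singleton_iff.1 hyz]

theorem inner_nonpos_of_mem_regularNormalCone {Θ : Set E} {x v z : E}
    (hv : v ∈ regularNormalCone Θ x) (hz : z ∈ contingentCone Θ x) : inner ℝ v z ≤ 0 := by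
  obtain ⟨τ, w, hτ, hw, hτ0, hwz⟩ := hz
  have hlim : Tendsto (fun k => x + τ k • w k) atTop (𝓝[Θ] x) := by
    refine tendsto_nhdsWithin_iff.2 ⟨?_, Eventually.of_forall hw⟩
    simpa using (hτ0.smul hwz).const_add x
  have key : ∀ ε : ℝ, 0 < ε → inner ℝ v z ≤ ε * ‖z‖ := by
    intro ε hε
    refine le_of_tendsto_of_tendsto (tendsto_const_nhds.inner hwz) (hwz.norm.const_mul ε) ?_
    filter_upwards [hlim.eventually (hv ε hε)] with k hk
    rw [add_sub_cancel_left, inner_smul_right, norm_smul, Real.norm_of_nonneg (hτ k).le] at hk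
    have : τ k * inner ℝ v (w k) ≤ τ k * (ε * ‖w k‖) := by linarith
    exact le_of_mul_le_mul_left this (hτ k)
  have : Tendsto (fun ε : ℝ => ε * ‖z‖) (𝓝[>] 0) (𝓝 0) := by
    have : Tendsto (fun ε : ℝ => ε * ‖z‖) (𝓝 0) (𝓝 (0 * ‖z‖)) := tendsto_id.mul_const _
    rw [zero_mul] at this
    exact this.mono_left nhdsWithin_le_nhds
  exact ge_of_tendsto this (by filter_upwards [self_mem_nhdsWithin] with ε hε using key ε hε)

/-- In finite dimension the regular normal cone is the polar of the contingent cone. -/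
theorem mem_regularNormalCone_iff_forall_contingentCone [FiniteDimensional ℝ E] {Θ : Set E}
    {x v : E} :
    v ∈ regularNormalCone Θ x ↔ ∀ z ∈ contingentCone Θ x, inner ℝ v z ≤ 0 := by
  refine ⟨fun hv z hz => inner_nonpos_of_mem_regularNormalCone hv hz, fun h ε hε => ?_⟩
  by_contra hcon
  have hfreq : ∃ᶠ y in 𝓝[Θ] x, ε * ‖y - x‖ < inner ℝ v (y - x) := by
    exact (not_eventually.1 hcon).mono fun y hy => not_le.1 hy
  obtain ⟨y, hy, hyε⟩ := exists_seq_forall_of_frequently hfreq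
  obtain ⟨hyx, hyΘ⟩ := tendsto_nhdsWithin_iff.1 hy
  obtain ⟨N, hN⟩ := eventually_atTop.1 hyΘ
  have hpos : ∀ k, 0 < ‖y k - x‖ := by
    intro k
    rw [norm_pos_iff]
    intro h0
    have := hyε k
    simp [h0] at this
  have hb : ∀ k, ‖y k - x‖⁻¹ • (y k - x) ∈ Metric.closedBall (0 : E) 1 := by
    intro k
    rw [mem_closedBall_zero_iff, norm_smul, norm_inv, norm_norm, inv_mul_cancel₀ (hpos k).ne']
  obtain ⟨z, -, φ, hφ, hlim⟩ := (isCompact_closedBall (0 : E) 1).tendsto_subseq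
    fun k => hb (k + N)
  have hφN : Tendsto (fun k => φ k + N) atTop atTop :=
    (tendsto_add_atTop_nat N).comp hφ.tendsto_atTop
  have hz : z ∈ contingentCone Θ x := by
    refine ⟨fun k => ‖y (φ k + N) - x‖, fun k => ‖y (φ k + N) - x‖⁻¹ • (y (φ k + N) - x),
      fun k => hpos _, fun k => ?_, ?_, hlim⟩
    · rw [smul_smul, mul_inv_cancel₀ (hpos _).ne', one_smul, add_sub_cancel]
      exact hN _ (Nat.le_add_left _ _)
    · have : Tendsto (fun k => ‖y k - x‖) atTop (𝓝 0) := by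
        simpa using (hyx.sub_const x).norm
      exact this.comp hφN
  have hge : ε ≤ inner ℝ v z := by
    refine ge_of_tendsto ((tendsto_const_nhds (x := v)).inner hlim)
      (Eventually.of_forall fun k => ?_)
    simp only [Function.comp_apply]
    rw [inner_smul_right, inv_mul_eq_div, le_div_iff₀ (hpos _)]
    exact (hyε _).le
  linarith [h z hz]

theorem isClosed_regularNormalCone [FiniteDimensional ℝ E] (Θ : Set E) (x : E) :
    IsClosed (regularNormalCone Θ x) := by
  have : regularNormalCone Θ x = ⋂ z ∈ contingentCone Θ x, {v | inner ℝ v z ≤ 0} := by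
    ext v
    simp [mem_regularNormalCone_iff_forall_contingentCone]
  rw [this]
  exact isClosed_biInter fun z _ => isClosed_le (by fun_prop) continuous_const

theorem convex_regularNormalCone [FiniteDimensional ℝ E] (Θ : Set E) (x : E) :
    Convex ℝ (regularNormalCone Θ x) := by
  intro v hv w hw a b ha hb _
  rw [mem_regularNormalCone_iff_forall_contingentCone] at *
  intro z hz
  rw [inner_add_left, inner_smul_left, inner_smul_left]
  have h1 := mul_nonpos_of_nonneg_of_nonpos ha (hv z hz)
  have h2 := mul_nonpos_of_nonneg_of_nonpos hb (hw z hz)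
  simpa using add_nonpos h1 h2

theorem smul_mem_regularNormalCone {Θ : Set E} {x v : E} (hv : v ∈ regularNormalCone Θ x) {c : ℝ}
    (hc : 0 < c) : c • v ∈ regularNormalCone Θ x := by
  intro ε hε
  filter_upwards [hv (ε / c) (div_pos hε hc)] with y hy
  rw [inner_smul_left]
  calc (starRingEnd ℝ) c * inner ℝ v (y - x) ≤ c * (ε / c * ‖y - x‖) := by
        simpa using mul_le_mul_of_nonneg_left hy hc.le
    _ = ε * ‖y - x‖ := by field_simp

theorem smul_mem_limitingNormalCone {Θ : Set E} {x v : E} (hv : v ∈ limitingNormalCone Θ x)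
    {c : ℝ} (hc : 0 < c) : c • v ∈ limitingNormalCone Θ x := by
  obtain ⟨y, w, hy, hw, hyx, hwv⟩ := hv
  exact ⟨y, fun k => c • w k, hy, fun k => smul_mem_regularNormalCone (hw k) hc, hyx,
    hwv.const_smul c⟩

/-- Proximal normals are regular normals. -/
theorem sub_mem_regularNormalCone_of_forall_norm_le {Θ : Set E} {t y : E}
    (h : ∀ z ∈ Θ, ‖t - y‖ ≤ ‖t - z‖) : t - y ∈ regularNormalCone Θ y := by
  intro ε hε
  have h1 : ∀ᶠ z in 𝓝[Θ] y, ‖z - y‖ < ε := by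
    have : Tendsto (fun z => ‖z - y‖) (𝓝 y) (𝓝 ‖y - y‖) :=
      (continuous_id.sub continuous_const).norm.tendsto y
    rw [sub_self, norm_zero] at this
    exact nhdsWithin_le_nhds (this.eventually (gt_mem_nhds hε))
  filter_upwards [h1, self_mem_nhdsWithin] with z hz hzΘ
  have h2 : ‖t - y‖ ^ 2 ≤ ‖t - z‖ ^ 2 := by gcongr; exact h z hzΘ
  have h3 : ‖t - z‖ ^ 2 = ‖t - y‖ ^ 2 - 2 * inner ℝ (t - y) (z - y) + ‖z - y‖ ^ 2 := by
    rw [← norm_sub_sq_real, sub_sub_sub_cancel_right]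
  -- `h2` and `h3` give `⟪t - y, z - y⟫ ≤ ‖z - y‖² / 2`, which is of second order.
  nlinarith [norm_nonneg (z - y)]

/-- If `u` is nearest to `t` in `C`, it is the only nearest point of `C` to the midpoint of `u`
and `t`. -/
theorem eq_of_norm_midpoint_sub_le {C : Set E} {t u z : E} (h : ∀ y ∈ C, ‖t - u‖ ≤ ‖t - y‖)
    (hz : z ∈ C) (hle : ‖u + (2⁻¹ : ℝ) • (t - u) - z‖ ≤ ‖(2⁻¹ : ℝ) • (t - u)‖) : z = u := by
  have h1 : ‖(2⁻¹ : ℝ) • (t - u) - (z - u)‖ ^ 2 ≤ ‖(2⁻¹ : ℝ) • (t - u)‖ ^ 2 := by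
    gcongr
    rwa [show (2⁻¹ : ℝ) • (t - u) - (z - u) = u + (2⁻¹ : ℝ) • (t - u) - z by abel]
  have h2 : ‖t - u‖ ^ 2 ≤ ‖(t - u) - (z - u)‖ ^ 2 := by
    gcongr
    rw [sub_sub_sub_cancel_right]
    exact h z hz
  rw [norm_sub_sq_real, inner_smul_left] at h1
  rw [norm_sub_sq_real (t - u)] at h2
  simp only [map_inv₀, map_ofNat] at h1
  -- `h1` amounts to `‖z - u‖² ≤ ⟪t - u, z - u⟫`, and `h2` to `2⟪t - u, z - u⟫ ≤ ‖z - u‖²`.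
  have h3 : ‖z - u‖ ^ 2 ≤ 0 := by linarith
  have h4 : ‖z - u‖ = 0 := by nlinarith [norm_nonneg (z - u)]
  exact sub_eq_zero.1 (norm_eq_zero.1 h4)

/-- Proximal normals to the contingent cone, at any of its points, are limiting normals to the
set itself. -/
theorem sub_mem_limitingNormalCone_of_nearest_contingentCone [FiniteDimensional ℝ E] {Θ : Set E}
    (hΘ : IsClosed Θ) {x t u : E} (hu : u ∈ contingentCone Θ x)
    (h : ∀ z ∈ contingentCone Θ x, ‖t - u‖ ≤ ‖t - z‖) : t - u ∈ limitingNormalCone Θ x := by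
  -- `t` may have several nearest points in the cone, and rescaled projections could converge to
  -- another one. From the midpoint `p` only `u` is nearest, and halving the normal is harmless in a
  -- cone.
  set p : E := u + (2⁻¹ : ℝ) • (t - u) with hp
  suffices hs : p - u ∈ limitingNormalCone Θ x by
    have := smul_mem_limitingNormalCone hs (c := 2) two_pos
    rwa [hp, add_sub_cancel_left, smul_smul, mul_inv_cancel₀ two_ne_zero, one_smul] at this
  obtain ⟨τ, w, hτ, hw, hτ0, hwu⟩ := id hu
  have hproj : ∀ k, ∃ a ∈ Θ, ∀ b ∈ Θ, ‖x + τ k • p - a‖ ≤ ‖x + τ k • p - b‖ := by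
    intro k
    obtain ⟨a, ha, hda⟩ := hΘ.exists_infDist_eq_dist ⟨_, hw k⟩ (x + τ k • p)
    refine ⟨a, ha, fun b hb => ?_⟩
    rw [← dist_eq_norm, ← dist_eq_norm, ← hda]
    exact Metric.infDist_le_dist_of_mem hb
  choose a ha hmin using hproj
  -- Rescaled projections of `x + τ k • p` onto `Θ`. They are at least as close to `p` as `w k`, so
  -- every cluster point is a nearest point of the cone, that is, `u`.
  set y : ℕ → E := fun k => (τ k)⁻¹ • (a k - x) with hy
  have hay : ∀ k, a k = x + τ k • y k := by
    intro k
    simp only [hy]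
    rw [smul_smul, mul_inv_cancel₀ (hτ k).ne', one_smul, add_sub_cancel]
  have hpy : ∀ k, x + τ k • p - a k = τ k • (p - y k) := by
    intro k
    rw [hay k, add_sub_add_left_eq_sub, smul_sub]
  have hle : ∀ k, ‖p - y k‖ ≤ ‖p - w k‖ := by
    intro k
    have h1 := hmin k _ (hw k)
    rw [hpy, add_sub_add_left_eq_sub, ← smul_sub, norm_smul, norm_smul,
      Real.norm_of_nonneg (hτ k).le] at h1
    exact le_of_mul_le_mul_left h1 (hτ k)
  have hpw : Tendsto (fun k => ‖p - w k‖) atTop (𝓝 ‖p - u‖) := (hwu.const_sub p).norm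
  obtain ⟨R, hR⟩ := hpw.bddAbove_range
  have hb : ∀ k, y k ∈ Metric.closedBall p R := fun k => by
    rw [Metric.mem_closedBall, dist_comm, dist_eq_norm]
    exact (hle k).trans (hR ⟨k, rfl⟩)
  obtain ⟨z, -, φ, hφ, hlim⟩ := (isCompact_closedBall p R).tendsto_subseq hb
  have hτφ := hτ0.comp hφ.tendsto_atTop
  have hz : z ∈ contingentCone Θ x :=
    ⟨τ ∘ φ, y ∘ φ, fun k => hτ _, fun k => by simpa [← hay] using ha (φ k), hτφ, hlim⟩
  have hzu : z = u := by
    refine eq_of_norm_midpoint_sub_le h hz ?_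
    have := le_of_tendsto_of_tendsto (hlim.const_sub p).norm (hpw.comp hφ.tendsto_atTop)
      (Eventually.of_forall fun k => hle (φ k))
    rwa [hp, add_sub_cancel_left] at this
  subst hzu
  refine ⟨a ∘ φ, fun k => p - y (φ k), fun k => ha _, fun k => ?_, ?_, hlim.const_sub p⟩
  · have h1 := sub_mem_regularNormalCone_of_forall_norm_le (hmin (φ k))
    have h2 := smul_mem_regularNormalCone h1 (inv_pos.2 (hτ (φ k)))
    rwa [hpy, smul_smul, inv_mul_cancel₀ (hτ _).ne', one_smul] at h2
  · have h1 := (hτφ.smul hlim).const_add x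
    rw [zero_smul, add_zero] at h1
    refine h1.congr fun k => ?_
    simp [← hay]

end Geometry

/-! ### Integral penalties, stationarity and measurability. -/

section Measure

variable {Ω : Type*} [MeasurableSpace Ω]

/-- A function squeezed between integrable functions whose integrals approach a common value is
integrable with that integral. -/
theorem integrable_and_integral_eq_of_squeeze {ν : Measure Ω} {a : Ω → ℝ} {c B : ℝ}
    (hlow : ∀ s : ℝ, 0 < s → ∃ l : Ω → ℝ, Integrable l ν ∧ l ≤ᵐ[ν] a ∧ c - B * s ≤ ∫ ω, l ω ∂ν)
    (hup : ∀ s : ℝ, 0 < s → ∃ l : Ω → ℝ, Integrable l ν ∧ a ≤ᵐ[ν] l ∧ ∫ ω, l ω ∂ν ≤ c + B * s) :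
    Integrable a ν ∧ ∫ ω, a ω ∂ν = c := by
  have hpos : ∀ m : ℕ, (0 : ℝ) < 1 / ((m : ℝ) + 1) := fun m => by positivity
  choose l hli hla hlc using fun m : ℕ => hlow _ (hpos m)
  choose u hui hua huc using fun m : ℕ => hup _ (hpos m)
  have hla' : ∀ᵐ ω ∂ν, ∀ m, l m ω ≤ a ω := ae_all_iff.2 hla
  have hua' : ∀ᵐ ω ∂ν, ∀ m, a ω ≤ u m ω := ae_all_iff.2 hua
  -- `a` is not known to be measurable. The countable envelopes are, and `L ≤ a ≤ U` with `∫ U ≤ c ≤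
  -- ∫ L` forces `L = a` almost everywhere.
  set L : Ω → ℝ := fun ω => ⨆ m, l m ω with hL
  set U : Ω → ℝ := fun ω => ⨅ m, u m ω with hU
  have hlL : ∀ᵐ ω ∂ν, ∀ m, l m ω ≤ L ω := by
    filter_upwards [hla'] with ω h m
    exact le_ciSup (f := fun m => l m ω) ⟨a ω, by rintro _ ⟨m, rfl⟩; exact h m⟩ m
  have hUu : ∀ᵐ ω ∂ν, ∀ m, U ω ≤ u m ω := by
    filter_upwards [hua'] with ω h m
    exact ciInf_le (f := fun m => u m ω) ⟨a ω, by rintro _ ⟨m, rfl⟩; exact h m⟩ m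
  have hLa : ∀ᵐ ω ∂ν, L ω ≤ a ω := by
    filter_upwards [hla'] with ω h using ciSup_le h
  have haU : ∀ᵐ ω ∂ν, a ω ≤ U ω := by
    filter_upwards [hua'] with ω h using le_ciInf h
  have hLm : AEStronglyMeasurable L ν :=
    (AEMeasurable.iSup fun m => (hli m).aemeasurable).aestronglyMeasurable
  have hUm : AEStronglyMeasurable U ν :=
    (AEMeasurable.iInf fun m => (hui m).aemeasurable).aestronglyMeasurable
  have hLi : Integrable L ν := integrable_of_le_of_le hLm
    (by filter_upwards [hlL] with ω h using h 0)
    (by filter_upwards [hLa, hua'] with ω h1 h2 using h1.trans (h2 0)) (hli 0) (hui 0)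
  have hUi : Integrable U ν := integrable_of_le_of_le hUm
    (by filter_upwards [haU, hla'] with ω h1 h2 using (h2 0).trans h1)
    (by filter_upwards [hUu] with ω h using h 0) (hli 0) (hui 0)
  have hlim : Tendsto (fun m : ℕ => B * (1 / ((m : ℝ) + 1))) atTop (𝓝 0) := by
    simpa using (tendsto_one_div_add_atTop_nhds_zero_nat (𝕜 := ℝ)).const_mul B
  have hcL : c ≤ ∫ ω, L ω ∂ν := by
    have h1 : Tendsto (fun m : ℕ => c - B * (1 / ((m : ℝ) + 1))) atTop (𝓝 c) := by
      simpa using hlim.const_sub c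
    refine le_of_tendsto h1 (Eventually.of_forall fun m => (hlc m).trans ?_)
    exact integral_mono_ae (hli m) hLi (by filter_upwards [hlL] with ω h using h m)
  have hUc : ∫ ω, U ω ∂ν ≤ c := by
    have h1 : Tendsto (fun m : ℕ => c + B * (1 / ((m : ℝ) + 1))) atTop (𝓝 c) := by
      simpa using hlim.const_add c
    refine ge_of_tendsto h1 (Eventually.of_forall fun m => le_trans ?_ (huc m))
    exact integral_mono_ae hUi (hui m) (by filter_upwards [hUu] with ω h using h m)
  have hLU : ∀ᵐ ω ∂ν, L ω ≤ U ω := by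
    filter_upwards [hLa, haU] with ω h1 h2 using h1.trans h2
  have hLUint := integral_mono_ae hLi hUi hLU
  have hzero : ∫ ω, (U ω - L ω) ∂ν = 0 := by
    rw [integral_sub hUi hLi]
    linarith
  have heq : L =ᵐ[ν] a := by
    have := (integral_eq_zero_iff_of_nonneg_ae
      (by filter_upwards [hLU] with ω h using sub_nonneg.2 h) (hUi.sub hLi)).1 hzero
    filter_upwards [this, hLa, haU] with ω h1 h2 h3
    have : U ω - L ω = 0 := h1
    linarith
  exact ⟨hLi.congr heq, by rw [← integral_congr_ae heq]; linarith⟩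

section Penalty

variable {E : Type*} [NormedAddCommGroup E] {ν : Measure Ω} [IsFiniteMeasure ν] {C : Ω → Set E}

theorem integrable_infDist_sq (hmeas : ∀ t, Measurable fun ω => Metric.infDist t (C ω))
    (h0 : ∀ᵐ ω ∂ν, (0 : E) ∈ C ω) (t : E) :
    Integrable (fun ω => Metric.infDist t (C ω) ^ 2) ν := by
  refine Integrable.mono' (integrable_const (‖t‖ ^ 2))
    ((hmeas t).pow_const 2).aestronglyMeasurable ?_
  filter_upwards [h0] with ω h
  rw [Real.norm_of_nonneg (by positivity)]
  have := Metric.infDist_le_dist_of_mem (x := t) h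
  rw [dist_zero_right] at this
  gcongr
  exact Metric.infDist_nonneg

theorem continuous_integral_infDist_sq (hmeas : ∀ t, Measurable fun ω => Metric.infDist t (C ω))
    (h0 : ∀ᵐ ω ∂ν, (0 : E) ∈ C ω) :
    Continuous fun t => ∫ ω, Metric.infDist t (C ω) ^ 2 ∂ν := by
  rw [continuous_iff_continuousAt]
  intro t
  refine continuousAt_of_dominated (bound := fun _ => (‖t‖ + 1) ^ 2)
    (Eventually.of_forall fun s => ((hmeas s).pow_const 2).aestronglyMeasurable) ?_
    (integrable_const _)
    (Eventually.of_forall fun ω => ((Metric.continuous_infDist_pt _).pow 2).continuousAt)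
  have h1 : ∀ᶠ s in 𝓝 t, ‖s‖ < ‖t‖ + 1 :=
    continuous_norm.continuousAt.eventually (gt_mem_nhds (lt_add_one _))
  filter_upwards [h1] with s hs
  filter_upwards [h0] with ω h
  rw [Real.norm_of_nonneg (by positivity)]
  have := Metric.infDist_le_dist_of_mem (x := s) h
  rw [dist_zero_right] at this
  gcongr
  · exact Metric.infDist_nonneg
  · linarith

end Penalty

variable {E : Type*} [NormedAddCommGroup E] [InnerProductSpace ℝ E] [FiniteDimensional ℝ E]

theorem integrable_of_forall_integrable_inner {ν : Measure Ω} {f : Ω → E}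
    (h : ∀ e : E, Integrable (fun ω => inner ℝ (f ω) e) ν) : Integrable f ν := by
  let b := stdOrthonormalBasis ℝ E
  have : f = fun ω => ∑ i, (inner ℝ (f ω) (b i)) • b i := by
    funext ω
    conv_lhs => rw [← b.sum_repr' (f ω)]
    simp only [real_inner_comm]
  rw [this]
  exact integrable_finsetSum _ fun i _ => (h (b i)).smul_const _

section Projection

variable {ν : Measure Ω} [IsFiniteMeasure ν] {C : Ω → Set E}

/-- Stationarity for the penalised projection problem: at a minimiser `t`, every selection of
nearest points is integrable, and the integral of the residuals balances `v - t`. -/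
theorem integrable_and_integral_sub_of_isMin
    (hmeas : ∀ t, Measurable fun ω => Metric.infDist t (C ω))
    (h0 : ∀ᵐ ω ∂ν, (0 : E) ∈ C ω) {k : ℝ} (hk : 0 < k) {v t : E}
    (hmin : ∀ s : E, ‖t - v‖ ^ 2 + k * ∫ ω, Metric.infDist t (C ω) ^ 2 ∂ν ≤
      ‖s - v‖ ^ 2 + k * ∫ ω, Metric.infDist s (C ω) ^ 2 ∂ν)
    {u : Ω → E} (hu : ∀ᵐ ω ∂ν, u ω ∈ C ω ∧ Metric.infDist t (C ω) = ‖t - u ω‖) :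
    Integrable (fun ω => t - u ω) ν ∧ k • ∫ ω, (t - u ω) ∂ν = v - t := by
  have hint := integrable_infDist_sq hmeas h0
  -- Testing `u ω` as a competitor at `t + s • e` bounds `⟪t - u ω, e⟫` below by a difference
  -- quotient of the squared distance, up to `s‖e‖²/2`; this remainder integrates to the `ν`-term.
  -- Minimality of `t` bounds the integrated quotient and contributes `‖e‖²/(2k)`.
  have hlow : ∀ e : E, ∀ s : ℝ, 0 < s → ∃ l : Ω → ℝ, Integrable l ν ∧
      l ≤ᵐ[ν] (fun ω => inner ℝ (t - u ω) e) ∧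
      inner ℝ (v - t) e / k - (‖e‖ ^ 2 / (2 * k) + ‖e‖ ^ 2 / 2 * ν.real Set.univ) * s ≤
        ∫ ω, l ω ∂ν := by
    intro e s hs
    refine ⟨fun ω => (2 * s)⁻¹ * (Metric.infDist (t + s • e) (C ω) ^ 2 -
      Metric.infDist t (C ω) ^ 2) - s / 2 * ‖e‖ ^ 2,
      (((hint _).sub (hint _)).const_mul _).sub (integrable_const _), ?_, ?_⟩
    · filter_upwards [hu] with ω ⟨h1, h2⟩
      have h3 := Metric.infDist_le_dist_of_mem (x := t + s • e) h1
      rw [dist_eq_norm, add_sub_right_comm] at h3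
      have h4 : Metric.infDist (t + s • e) (C ω) ^ 2 ≤ ‖t - u ω + s • e‖ ^ 2 := by
        gcongr
        exact Metric.infDist_nonneg
      rw [norm_add_sq_real, inner_smul_right, norm_smul, Real.norm_of_nonneg hs.le] at h4
      rw [h2]
      have h5 : (2 * s)⁻¹ * (Metric.infDist (t + s • e) (C ω) ^ 2 - ‖t - u ω‖ ^ 2) ≤
          (2 * s)⁻¹ * (2 * (s * inner ℝ (t - u ω) e) + (s * ‖e‖) ^ 2) := by
        gcongr
        linarith
      have h6 : (2 * s)⁻¹ * (2 * (s * inner ℝ (t - u ω) e) + (s * ‖e‖) ^ 2) =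
          inner ℝ (t - u ω) e + s / 2 * ‖e‖ ^ 2 := by
        field_simp
      linarith
    · have hi1 : Integrable (fun ω => (2 * s)⁻¹ * (Metric.infDist (t + s • e) (C ω) ^ 2 -
          Metric.infDist t (C ω) ^ 2)) ν := ((hint _).sub (hint _)).const_mul _
      rw [integral_sub hi1 (integrable_const _), integral_const_mul,
        integral_sub (hint _) (hint _), integral_const]
      have h1 := hmin (t + s • e)
      rw [add_sub_right_comm, norm_add_sq_real, inner_smul_right, norm_smul,
        Real.norm_of_nonneg hs.le] at h1
      have h2 : inner ℝ (v - t) e = - inner ℝ (t - v) e := by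
        rw [← inner_neg_left, neg_sub]
      set D := ∫ ω, Metric.infDist (t + s • e) (C ω) ^ 2 ∂ν
      set D0 := ∫ ω, Metric.infDist t (C ω) ^ 2 ∂ν
      have h3 : -(2 * (s * inner ℝ (t - v) e) + (s * ‖e‖) ^ 2) / k ≤ D - D0 := by
        rw [div_le_iff₀ hk]
        linarith
      have h4 : (2 * s)⁻¹ * (-(2 * (s * inner ℝ (t - v) e) + (s * ‖e‖) ^ 2) / k) ≤
          (2 * s)⁻¹ * (D - D0) := by
        gcongr
      have h5 : (2 * s)⁻¹ * (-(2 * (s * inner ℝ (t - v) e) + (s * ‖e‖) ^ 2) / k) =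
          - inner ℝ (t - v) e / k - ‖e‖ ^ 2 / (2 * k) * s := by
        field_simp
        ring
      rw [h2, smul_eq_mul]
      linarith
  have key : ∀ e : E, Integrable (fun ω => inner ℝ (t - u ω) e) ν ∧
      ∫ ω, inner ℝ (t - u ω) e ∂ν = inner ℝ (v - t) e / k := by
    intro e
    refine integrable_and_integral_eq_of_squeeze (hlow e) fun s hs => ?_
    -- The direction `-e` turns lower bounds into upper ones, so neither differentiability of the
    -- squared distance nor a measurable choice of `u` is needed.
    obtain ⟨l, h1, h2, h3⟩ := hlow (-e) s hs
    refine ⟨fun ω => - l ω, h1.neg, ?_, ?_⟩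
    · filter_upwards [h2] with ω h
      rw [inner_neg_right] at h
      linarith
    · rw [integral_neg]
      rw [inner_neg_right, norm_neg, neg_div] at h3
      linarith
  have hI : Integrable (fun ω => t - u ω) ν :=
    integrable_of_forall_integrable_inner fun e => (key e).1
  refine ⟨hI, ext_inner_right ℝ fun e => ?_⟩
  have h1 := (key e).2
  simp only [real_inner_comm e] at h1
  rw [inner_smul_left, real_inner_comm e, ← integral_inner (𝕜 := ℝ) hI e, h1, conj_trivial,
    real_inner_comm e, mul_div_cancel₀ _ hk.ne']

theorem exists_isMin_penalty (hmeas : ∀ t, Measurable fun ω => Metric.infDist t (C ω))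
    (h0 : ∀ᵐ ω ∂ν, (0 : E) ∈ C ω) {k : ℝ} (hk : 0 ≤ k) (v : E) :
    ∃ t : E, ∀ s : E, ‖t - v‖ ^ 2 + k * ∫ ω, Metric.infDist t (C ω) ^ 2 ∂ν ≤
      ‖s - v‖ ^ 2 + k * ∫ ω, Metric.infDist s (C ω) ^ 2 ∂ν := by
  refine Continuous.exists_forall_le (by
    have := continuous_integral_infDist_sq hmeas h0
    fun_prop) ?_
  have h1 : Tendsto (fun s : E => ‖s - v‖ ^ 2) (cocompact E) atTop := by
    refine (tendsto_pow_atTop two_ne_zero).comp ?_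
    simp only [← dist_eq_norm]
    exact tendsto_dist_left_cocompact_atTop v |>.congr fun s => dist_comm _ _
  refine tendsto_atTop_mono (fun s => ?_) h1
  have : 0 ≤ ∫ ω, Metric.infDist s (C ω) ^ 2 ∂ν := integral_nonneg fun ω => sq_nonneg _
  have := mul_nonneg hk this
  linarith

/-- A vector in the polar of the essential intersection of closed sets is approximated by
integrals of multiples of proximal normals. -/
theorem mem_closure_integral_sub_of_forall_essInter
    (hmeas : ∀ t, Measurable fun ω => Metric.infDist t (C ω)) (hC : ∀ ω, IsClosed (C ω))
    (h0 : ∀ᵐ ω ∂ν, (0 : E) ∈ C ω) {v : E}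
    (hv : ∀ z : E, (∀ᵐ ω ∂ν, z ∈ C ω) → inner ℝ v z ≤ 0) :
    v ∈ closure {y : E | ∃ (k : ℝ) (t : E) (u : Ω → E), 0 < k ∧
      (∀ᵐ ω ∂ν, u ω ∈ C ω ∧ ∀ z ∈ C ω, ‖t - u ω‖ ≤ ‖t - z‖) ∧
      Integrable (fun ω => t - u ω) ν ∧ k • ∫ ω, (t - u ω) ∂ν = y} := by
  choose t ht using fun m : ℕ =>
    exists_isMin_penalty hmeas h0 (k := (m : ℝ) + 1) (by positivity) v
  have hF0 : ∫ ω, Metric.infDist (0 : E) (C ω) ^ 2 ∂ν = 0 := by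
    refine integral_eq_zero_of_ae ?_
    filter_upwards [h0] with ω h
    simp [Metric.infDist_zero_of_mem h]
  have hF : ∀ s : E, 0 ≤ ∫ ω, Metric.infDist s (C ω) ^ 2 ∂ν := fun s =>
    integral_nonneg fun ω => sq_nonneg _
  have hbound : ∀ m : ℕ, ‖t m - v‖ ^ 2 +
      ((m : ℝ) + 1) * ∫ ω, Metric.infDist (t m) (C ω) ^ 2 ∂ν ≤ ‖v‖ ^ 2 := by
    intro m
    -- The competitor `0` has zero penalty.
    simpa [hF0] using ht m 0
  have hnorm : ∀ m, ‖t m - v‖ ≤ ‖v‖ := by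
    intro m
    have h1 := hbound m
    have h2 := mul_nonneg (by positivity : (0 : ℝ) ≤ (m : ℝ) + 1) (hF (t m))
    exact le_of_sq_le_sq (by linarith) (norm_nonneg _)
  obtain ⟨z, -, φ, hφ, hlim⟩ := (isCompact_closedBall v ‖v‖).tendsto_subseq
    (x := t) fun m => by simpa [dist_eq_norm] using hnorm m
  have hFz : ∫ ω, Metric.infDist z (C ω) ^ 2 ∂ν = 0 := by
    refine le_antisymm ?_ (hF z)
    have h1 := ((continuous_integral_infDist_sq hmeas h0).tendsto z).comp hlim
    have h2 : Tendsto (fun m => ‖v‖ ^ 2 * (1 / ((φ m : ℝ) + 1))) atTop (𝓝 0) := by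
      simpa using ((tendsto_one_div_add_atTop_nhds_zero_nat (𝕜 := ℝ)).comp
        hφ.tendsto_atTop).const_mul (‖v‖ ^ 2)
    refine le_of_tendsto_of_tendsto h1 h2 (Eventually.of_forall fun m => ?_)
    have h3 := hbound (φ m)
    simp only [Function.comp_apply]
    rw [mul_one_div, le_div_iff₀ (by positivity)]
    linarith [sq_nonneg ‖t (φ m) - v‖]
  have hzC : ∀ᵐ ω ∂ν, z ∈ C ω := by
    have := (integral_eq_zero_iff_of_nonneg_ae (Eventually.of_forall fun ω => sq_nonneg _)
      (integrable_infDist_sq hmeas h0 z)).1 hFz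
    filter_upwards [this, h0] with ω h1 h2
    rw [(hC ω).mem_iff_infDist_zero ⟨0, h2⟩]
    simpa using h1
  have hz0 : z = 0 := by
    have h1 : ‖z - v‖ ≤ ‖v‖ :=
      le_of_tendsto (hlim.sub_const v).norm (Eventually.of_forall fun m => hnorm _)
    have h2 : ‖z - v‖ ^ 2 ≤ ‖v‖ ^ 2 := by gcongr
    rw [norm_sub_sq_real, real_inner_comm] at h2
    -- `h2` expands to `‖z‖² ≤ 2⟪v, z⟫`, and `z` is tested against the polarity of `v`.
    have h3 : ‖z‖ ^ 2 ≤ 0 := by linarith [hv z hzC]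
    have h4 : ‖z‖ = 0 := by nlinarith [norm_nonneg z]
    exact norm_eq_zero.1 h4
  subst hz0
  have hlimv : Tendsto (fun m => v - t (φ m)) atTop (𝓝 v) := by
    simpa using hlim.const_sub v
  refine mem_closure_of_tendsto hlimv (Eventually.of_forall fun m => ?_)
  have hnear : ∀ ω, ∃ u : E, (C ω).Nonempty →
      u ∈ C ω ∧ Metric.infDist (t (φ m)) (C ω) = dist (t (φ m)) u := by
    intro ω
    by_cases h : (C ω).Nonempty
    · obtain ⟨u, hu⟩ := (hC ω).exists_infDist_eq_dist h (t (φ m))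
      exact ⟨u, fun _ => hu⟩
    · exact ⟨0, fun h' => absurd h' h⟩
  choose u hu using hnear
  have hu' : ∀ᵐ ω ∂ν, u ω ∈ C ω ∧ Metric.infDist (t (φ m)) (C ω) = ‖t (φ m) - u ω‖ := by
    filter_upwards [h0] with ω h
    rw [← dist_eq_norm]
    exact hu ω ⟨0, h⟩
  obtain ⟨h1, h2⟩ := integrable_and_integral_sub_of_isMin hmeas h0
    (by positivity : (0 : ℝ) < (φ m : ℝ) + 1) (ht (φ m)) hu'
  refine ⟨(φ m : ℝ) + 1, t (φ m), u, by positivity, ?_, h1, h2⟩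
  filter_upwards [hu'] with ω ⟨h3, h4⟩
  refine ⟨h3, fun y hy => ?_⟩
  rw [← h4, ← dist_eq_norm]
  exact Metric.infDist_le_dist_of_mem hy

end Projection

/-- The distance to the contingent cones of a measurable multifunction is measurable. -/
theorem MeasurableMultifunction.measurable_infDist_contingentCone {M : Ω → Set E}
    (hM : MeasurableMultifunction M) (x t : E) :
    Measurable fun ω => Metric.infDist t (contingentCone (M ω) x) := by
  have hmeet : ∀ r : ℝ, MeasurableSet
      {ω | (contingentCone (M ω) x ∩ Metric.closedBall t r).Nonempty} := by
    intro r
    -- The uncountable union over `τ` is taken inside `E`, where it is open; only the intersection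
    -- over `j` takes place in `Ω`.
    have : {ω | (contingentCone (M ω) x ∩ Metric.closedBall t r).Nonempty} =
        ⋂ j : ℕ, {ω | (M ω ∩ ⋃ τ ∈ Set.Ioo (0 : ℝ) (1 / ((j : ℝ) + 1)),
          (fun p : E => τ⁻¹ • (p - x)) ⁻¹' Metric.ball t (r + 1 / ((j : ℝ) + 1))).Nonempty} := by
      ext ω
      simp only [Set.mem_ofPred_eq, Set.mem_iInter, contingentCone_inter_closedBall_nonempty_iff]
      refine forall_congr' fun j => ⟨?_, ?_⟩
      · rintro ⟨τ, hτ, y, hy, hmem⟩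
        refine ⟨_, hmem, Set.mem_biUnion hτ ?_⟩
        rw [Set.mem_preimage, add_sub_cancel_left, smul_smul, inv_mul_cancel₀ hτ.1.ne', one_smul]
        exact hy
      · rintro ⟨p, hp, hpU⟩
        obtain ⟨τ, hτ, hy⟩ := Set.mem_iUnion₂.1 hpU
        refine ⟨τ, hτ, _, hy, ?_⟩
        rwa [smul_smul, mul_inv_cancel₀ hτ.1.ne', one_smul, add_sub_cancel]
    rw [this]
    exact MeasurableSet.iInter fun j => hM _ (isOpen_biUnion fun τ _ =>
      Metric.isOpen_ball.preimage (by fun_prop))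
  refine measurable_of_Iic fun r => ?_
  rcases lt_or_ge r 0 with hr | hr
  · convert MeasurableSet.empty
    ext ω
    simpa using hr.trans_le Metric.infDist_nonneg
  -- `infDist` to the empty set is `0`, so the sublevel set also contains every `ω` whose cone is
  -- empty, that is, misses all balls of integer radius.
  · have : (fun ω => Metric.infDist t (contingentCone (M ω) x)) ⁻¹' Set.Iic r =
        {ω | (contingentCone (M ω) x ∩ Metric.closedBall t r).Nonempty} ∪
          (⋃ m : ℕ, {ω | (contingentCone (M ω) x ∩ Metric.closedBall t (m : ℝ)).Nonempty})ᶜ := by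
      ext ω
      simp only [Set.mem_preimage, Set.mem_Iic, Set.mem_union, Set.mem_ofPred_eq, Set.mem_compl_iff,
        Set.mem_iUnion]
      constructor
      · intro h
        by_cases hne : (contingentCone (M ω) x).Nonempty
        · obtain ⟨y, hy, hyd⟩ := (isClosed_contingentCone (M ω) x).exists_infDist_eq_dist hne t
          refine Or.inl ⟨y, hy, ?_⟩
          rw [Metric.mem_closedBall, dist_comm, ← hyd]
          exact h
        · exact Or.inr fun ⟨m, y, hy, _⟩ => hne ⟨y, hy⟩
      · rintro (⟨y, hy, hyr⟩ | h)
        · refine (Metric.infDist_le_dist_of_mem hy).trans ?_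
          rwa [dist_comm]
        · have : contingentCone (M ω) x = ∅ := by
            by_contra hne
            obtain ⟨y, hy⟩ := Set.nonempty_iff_ne_empty.2 hne
            obtain ⟨m, hm⟩ := exists_nat_ge (dist y t)
            exact h ⟨m, y, hy, hm⟩
          rw [this, Metric.infDist_empty]
          exact hr
    rw [this]
    exact (hmeet r).union (MeasurableSet.iUnion fun m : ℕ => hmeet m).compl

end Measure

/-! ### The two inclusions for the Aumann integral. -/

section Main

variable {Ω : Type*} [MeasurableSpace Ω] {μ : Measure Ω}

theorem convex_aumannIntegral_of_ae {E : Type*} [NormedAddCommGroup E] [NormedSpace ℝ E]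
    {N : Ω → Set E} (hN : ∀ᵐ ω ∂μ, Convex ℝ (N ω)) :
    Convex ℝ (aumannIntegral μ N) := by
  rintro _ ⟨f, hf, hfN, rfl⟩ _ ⟨g, hg, hgN, rfl⟩ a b ha hb hab
  refine ⟨fun ω => a • f ω + b • g ω, (hf.smul a).add (hg.smul b), ?_, ?_⟩
  · filter_upwards [hN, hfN, hgN] with ω h h1 h2 using h h1 h2 ha hb hab
  · rw [← integral_smul, ← integral_smul]
    exact integral_add (hf.smul a) (hg.smul b)

variable {E : Type*} [NormedAddCommGroup E] [InnerProductSpace ℝ E] [FiniteDimensional ℝ E]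
  {M : Ω → Set E} {x : E}

theorem regularNormalCone_essInter_subset_closure [SigmaFinite μ]
    (hM : MeasurableMultifunction M) (hclosed : ∀ ω, IsClosed (M ω)) (hx : x ∈ essInter μ M)
    (hCHIP : MeasurableCHIP μ M x) :
    regularNormalCone (essInter μ M) x ⊆
      closure (aumannIntegral μ fun ω => limitingNormalCone (M ω) x) := by
  intro v hv
  -- A positive density of finite mass gives a finite measure with the same null sets.
  obtain ⟨g, hg0, hgm, hgi⟩ := exists_pos_lintegral_lt_of_sigmaFinite μ one_ne_zero
  set ν : Measure Ω := μ.withDensity fun ω => g ω with hν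
  have : IsFiniteMeasure ν := isFiniteMeasure_withDensity (hgi.trans ENNReal.one_lt_top).ne
  have hνμ : ν ≪ μ := withDensity_absolutelyContinuous _ _
  have hμν : μ ≪ ν := withDensity_absolutelyContinuous' hgm.coe_nnreal_ennreal.aemeasurable
    (Eventually.of_forall fun ω => by simpa using (hg0 ω).ne')
  have hpolar : ∀ z : E, (∀ᵐ ω ∂ν, z ∈ contingentCone (M ω) x) → inner ℝ v z ≤ 0 := by
    intro z hz
    refine inner_nonpos_of_mem_regularNormalCone hv ?_
    rw [hCHIP]
    exact hμν.ae_le hz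
  have h0 : ∀ᵐ ω ∂ν, (0 : E) ∈ contingentCone (M ω) x := by
    filter_upwards [hνμ.ae_le hx] with ω h using zero_mem_contingentCone h
  refine closure_mono ?_ (mem_closure_integral_sub_of_forall_essInter
    (fun t => hM.measurable_infDist_contingentCone x t)
    (fun ω => isClosed_contingentCone _ _) h0 hpolar)
  rintro _ ⟨k, t, u, hk, hu, hI, rfl⟩
  -- The weight `k` and the density `g ω` are positive, so the normal cones absorb them on returning
  -- to `μ`.
  refine ⟨fun ω => k • g ω • (t - u ω),
    ((integrable_withDensity_iff_integrable_smul hgm).1 hI).smul k, ?_, ?_⟩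
  · filter_upwards [hμν.ae_le hu] with ω ⟨h1, h2⟩
    refine smul_mem_limitingNormalCone ?_ hk
    exact smul_mem_limitingNormalCone (c := (g ω : ℝ))
      (sub_mem_limitingNormalCone_of_nearest_contingentCone (hclosed ω) h1 h2) (hg0 ω)
  · rw [integral_smul, hν, integral_withDensity_eq_integral_smul hgm]

/-- By CHIP a tangent `z` to the essential intersection is tangent to almost every `M ω`, and by
regularity the integrand is polar to it there; the sign survives integration. -/
theorem aumannIntegral_subset_regularNormalCone_essInter (hCHIP : MeasurableCHIP μ M x)
    (hreg : ∀ᵐ ω ∂μ, IsNormallyRegularAt (M ω) x) :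
    (aumannIntegral μ fun ω => limitingNormalCone (M ω) x) ⊆
      regularNormalCone (essInter μ M) x := by
  rintro _ ⟨f, hf, hfN, rfl⟩
  rw [mem_regularNormalCone_iff_forall_contingentCone, hCHIP]
  intro z hz
  rw [real_inner_comm, ← integral_inner hf]
  refine integral_nonpos_of_ae ?_
  filter_upwards [hreg, hfN, hz] with ω h1 h2 h3
  rw [← show regularNormalCone (M ω) x = limitingNormalCone (M ω) x from h1] at h2
  rw [real_inner_comm]
  exact inner_nonpos_of_mem_regularNormalCone h2 h3

end Main

end EssInter

theorem theorem5p5 {Ω : Type*} [MeasurableSpace Ω] (μ : MeasureTheory.Measure Ω)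
    [MeasureTheory.SigmaFinite μ] [μ.IsComplete] (hμ : 0 < μ Set.univ) (n : ℕ)
    (M : Ω → Set (EuclideanSpace ℝ (Fin n)))
    (hM : EssInter.MeasurableMultifunction M) (hclosed : ∀ ω, IsClosed (M ω))
    (x : EuclideanSpace ℝ (Fin n)) (hx : x ∈ EssInter.essInter μ M)
    (hCHIP : EssInter.MeasurableCHIP μ M x) :
    EssInter.regularNormalCone (EssInter.essInter μ M) x ⊆
        closure (EssInter.aumannIntegral μ fun ω => EssInter.limitingNormalCone (M ω) x) ∧
      ((∀ᵐ ω ∂μ, EssInter.IsNormallyRegularAt (M ω) x) →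
        EssInter.regularNormalCone (EssInter.essInter μ M) x =
            closure (EssInter.aumannIntegral μ fun ω => EssInter.limitingNormalCone (M ω) x) ∧
          intrinsicInterior ℝ (EssInter.regularNormalCone (EssInter.essInter μ M) x) =
            intrinsicInterior ℝ
              (EssInter.aumannIntegral μ fun ω => EssInter.limitingNormalCone (M ω) x)) := by
  have hsub := EssInter.regularNormalCone_essInter_subset_closure hM hclosed hx hCHIP
  refine ⟨hsub, fun hreg => ?_⟩
  have heq := hsub.antisymm (closure_minimal
    (EssInter.aumannIntegral_subset_regularNormalCone_essInter hCHIP hreg)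
    (EssInter.isClosed_regularNormalCone _ _))
  refine ⟨heq, ?_⟩
  rw [heq]
  -- Regularity makes almost all limiting normal cones convex, so convexity of the integral holds
  -- pointwise, without Lyapunov's theorem and even if `μ` has atoms.
  refine EssInter.intrinsicInterior_closure_of_convex (EssInter.convex_aumannIntegral_of_ae ?_)
  filter_upwards [hreg] with ω h
  rw [← show EssInter.regularNormalCone (M ω) x = EssInter.limitingNormalCone (M ω) x from h]
  exact EssInter.convex_regularNormalCone _ _
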